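/- Let $G$ be a Lie group whose Lie algebra $\mathfrak g$ is a real semisimple Lie algebra that is a split real form: there are a Cartan involution $\theta$ of $\mathfrak g$, with Cartan decomposition $\mathfrak g=\mathfrak k\oplus\mathfrak s$, and a maximal abelian subalgebra $\mathfrak a$ contained in $\mathfrak s$ which is a Cartan subalgebra of $\mathfrak g$. Let $\Pi$ be the set of roots of $(\mathfrak g,\mathfrak a)$, let $\Sigma\subset\Pi$ be a simple system of roots, and let $\langle\cdot,\cdot\rangle$ be the Killing form of $\mathfrak g$ and the inner product that it induces on $\mathfrak a^*$. For $\gamma\in\Sigma$ let $X_\gamma\in\mathfrak g_\gamma$ be a root vector and $X_{-\gamma}=-\theta(X_\gamma)\in\mathfrak g_{-\gamma}$, normalized by $\langle X_\gamma,X_{-\gamma}\rangle=\frac{2}{\langle\gamma,\gamma\rangle}$. Put $$A_\gamma=X_\gamma-X_{-\gamma},\qquad s_\gamma=\exp\left(\tfrac{\pi}{2}A_\gamma\right)\in G .$$ Suppose that $\alpha,\beta\in\Sigma$ are connected by a simple edge in the Dynkin diagram. Then for every $t\in[0,\pi]$ the following identities hold in $G$: $$\exp(tA_\alpha)\, s_\beta\,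 s_\alpha = s_\beta\, s_\alpha\, \exp(tA_\beta),$$ $$s_\alpha\, \exp(tA_\beta)\, s_\alpha = s_\beta\, \exp\big((\pi-t)A_\alpha\big)\, s_\beta .$$ -/

import Mathlib

open scoped Manifold

/-! ### The exponential map of a Lie group -/

section LieExponential

variable {E : Type*} [NormedAddCommGroup E] [NormedSpace ℝ E]
  {G : Type*} [TopologicalSpace G] [ChartedSpace E G] [Group G]
  [LieGroup 𝓘(ℝ, E) (minSmoothness ℝ 3) G]

/-- The Lie algebra of a finite-dimensional Lie group is finite-dimensional. -/
instance GroupLieAlgebra.moduleFinite [FiniteDimensional ℝ E] :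
    Module.Finite ℝ (GroupLieAlgebra 𝓘(ℝ, E) G) :=
  inferInstanceAs (Module.Finite ℝ E)

/-- Left translates of integral curves of a left-invariant vector field are integral curves. -/
theorem isMIntegralCurveOn_mul_left (v : GroupLieAlgebra 𝓘(ℝ, E) G) (g : G) {γ : ℝ → G}
    {s : Set ℝ} (hγ : IsMIntegralCurveOn γ (mulInvariantVectorField v) s) :
    IsMIntegralCurveOn (fun t ↦ g * γ t) (mulInvariantVectorField v) s := by
  intro t ht
  have M : minSmoothness ℝ 3 ≠ 0 := lt_of_lt_of_le (by simp) le_minSmoothness |>.ne'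
  have hL (h x : G) : MDiffAt (fun y : G ↦ h * y) x :=
    (contMDiff_mul_left (I := 𝓘(ℝ, E)) (n := minSmoothness ℝ 3)).contMDiffAt.mdifferentiableAt M
  have key := (hL g (γ t)).hasMFDerivAt.comp_hasMFDerivWithinAt t (hγ t ht)
  have hv : mulInvariantVectorField v (g * γ t) =
      mfderiv% (fun y : G ↦ g * y) (γ t) (mulInvariantVectorField v (γ t)) := by
    have D : (fun x : G ↦ g * γ t * x) = (fun y ↦ g * y) ∘ (fun x ↦ γ t * x) := by
      ext x; simp [mul_assoc]
    simp only [mulInvariantVectorField]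
    rw [D, mfderiv_comp (I' := 𝓘(ℝ, E)) _ (hL g _) (hL (γ t) 1)]
    change (mfderiv% (fun y : G ↦ g * y) (γ t * 1) : E →L[ℝ] E) _ = _
    rw [mul_one]
    rfl
  rw [hv]
  have hlin : (1 : ℝ →L[ℝ] ℝ).smulRight
      (mfderiv% (fun y : G ↦ g * y) (γ t) (mulInvariantVectorField v (γ t))) =
      (mfderiv% (fun y : G ↦ g * y) (γ t)).comp
        ((1 : ℝ →L[ℝ] ℝ).smulRight (mulInvariantVectorField v (γ t))) := by
    apply ContinuousLinearMap.ext
    intro r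
    exact (map_smul (mfderiv% (fun y : G ↦ g * y) (γ t)) _ _).symm
  rw [hlin]
  exact key

/-- Every left-invariant vector field has a global integral curve through the identity. -/
theorem exists_isMIntegralCurve_mulInvariantVectorField [FiniteDimensional ℝ E] [T2Space G]
    (v : GroupLieAlgebra 𝓘(ℝ, E) G) :
    ∃ γ : ℝ → G, γ 0 = 1 ∧ IsMIntegralCurve γ (mulInvariantVectorField v) := by
  have : IsManifold 𝓘(ℝ, E) 1 G :=
    IsManifold.of_le (n := minSmoothness ℝ 3) (by simp)
  have hv : CMDiff 1 (fun g : G ↦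
      (mulInvariantVectorField v g : TangentBundle 𝓘(ℝ, E) G)) :=
    (contMDiff_mulInvariantVectorField v).of_le (by simp)
  obtain ⟨γ, h0, hγ⟩ := exists_isMIntegralCurveAt_of_contMDiffAt_boundaryless (t₀ := 0)
    (hv.contMDiffAt (x := 1))
  obtain ⟨ε, hε, hγ⟩ := isMIntegralCurveAt_iff'.mp hγ
  rw [Real.ball_eq_Ioo, zero_sub, zero_add] at hγ
  exact exists_isMIntegralCurve_of_isMIntegralCurveOn hv hε
    (fun g ↦ ⟨fun t ↦ g * γ t, by simp [h0], isMIntegralCurveOn_mul_left v g hγ⟩) 1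

/-- The exponential map of a Lie group: `lieExp v` is the value at time `1` of the integral curve
through the identity of the left-invariant vector field determined by `v`. -/
noncomputable def lieExp [FiniteDimensional ℝ E] [T2Space G] (v : GroupLieAlgebra 𝓘(ℝ, E) G) : G :=
  (exists_isMIntegralCurve_mulInvariantVectorField v).choose 1

end LieExponential

/-! ### Cartan involutions and split semisimple real Lie algebras -/

section Split

variable {L : Type*} [LieRing L] [LieAlgebra ℝ L]

/-- A Cartan involution of a real Lie algebra: an involutive automorphism `θ` for which the
form `(x, y) ↦ -κ(x, θ y)` is positive definite, `κ` being the Killing form. -/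
structure IsCartanInvolution (θ : L ≃ₗ⁅ℝ⁆ L) : Prop where
  involutive : Function.Involutive θ
  pos : ∀ x, x ≠ 0 → 0 < -killingForm ℝ L x (θ x)

/-- `𝔞` is a maximal abelian subalgebra of the `-1`-eigenspace `𝔰` of `θ`, that is of the
noncompact part of the Cartan decomposition `L = 𝔨 ⊕ 𝔰`. -/
def IsMaximalAbelianInNoncompactPart (θ : L ≃ₗ⁅ℝ⁆ L) (𝔞 : LieSubalgebra ℝ L) : Prop :=
  Maximal (fun 𝔟 : LieSubalgebra ℝ L ↦ IsLieAbelian 𝔟 ∧ ∀ x ∈ 𝔟, θ x = -x) 𝔞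

/-- The elements of `𝔞` act diagonalizably on `L`, with real eigenvalues. -/
theorem IsMaximalAbelianInNoncompactPart.isTriangularizable [FiniteDimensional ℝ L]
    {θ : L ≃ₗ⁅ℝ⁆ L} {𝔞 : LieSubalgebra ℝ L} (hθ : IsCartanInvolution θ)
    (h𝔞 : IsMaximalAbelianInNoncompactPart θ 𝔞) :
    LieModule.IsTriangularizable ℝ 𝔞 L where
  maxGenEigenspace_eq_top x := by
    have hswap (u w : L) : killingForm ℝ L u (θ w) = killingForm ℝ L w (θ u) := by
      rw [← LieAlgebra.killingForm_of_equiv_apply θ w (θ u), hθ.involutive u,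
        LieModule.traceForm_comm]
    let core : InnerProductSpace.Core ℝ L :=
      { inner := fun u w ↦ -killingForm ℝ L u (θ w)
        conj_inner_symm := fun u w ↦ by simp [hswap u w]
        re_inner_nonneg := fun u ↦ by
          rcases eq_or_ne u 0 with rfl | hu
          · simp
          · simpa using (hθ.pos u hu).le
        add_left := fun u w z ↦ by simp; ring
        smul_left := fun u w r ↦ by simp
        definite := fun u hu ↦ by
          by_contra h
          exact (hθ.pos u h).ne' hu }
    let _ : NormedAddCommGroup L := core.toNormedAddCommGroup
    let _ : InnerProductSpace ℝ L := InnerProductSpace.ofCore core.toCore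
    have hsymm : (LieModule.toEnd ℝ 𝔞 L x).IsSymmetric := by
      intro u w
      change -killingForm ℝ L ⁅(x : L), u⁆ (θ w) = -killingForm ℝ L u (θ ⁅(x : L), w⁆)
      rw [LieEquiv.map_lie, h𝔞.prop.2 x x.2, neg_lie, map_neg, ← lie_skew (x : L) u, map_neg,
        LinearMap.neg_apply, LieModule.traceForm_apply_lie_apply]
    have htop := Submodule.orthogonal_eq_bot_iff.mp
      hsymm.orthogonalComplement_iSup_eigenspaces_eq_bot
    refine top_le_iff.mp (htop.symm.le.trans (iSup_mono fun μ ↦ ?_))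
    exact Module.End.genEigenspace_le_maximal _ μ 1

/-- The root system of a split semisimple real Lie algebra `L`: `𝔞` is both a maximal abelian
subalgebra of the noncompact part of a Cartan decomposition and a Cartan subalgebra of `L`. -/
noncomputable def splitRootSystem [FiniteDimensional ℝ L] [LieAlgebra.IsSemisimple ℝ L]
    {θ : L ≃ₗ⁅ℝ⁆ L} {𝔞 : LieSubalgebra ℝ L} [𝔞.IsCartanSubalgebra] (hθ : IsCartanInvolution θ)
    (h𝔞 : IsMaximalAbelianInNoncompactPart θ 𝔞) :
    RootPairing 𝔞.root ℝ (Module.Dual ℝ 𝔞) 𝔞 :=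
  haveI := h𝔞.isTriangularizable hθ
  LieAlgebra.IsKilling.rootSystem 𝔞

/-- The squared length `⟨α, α⟩ = κ(H_α, H_α)` of a root, where `H_α ∈ 𝔞` is the vector that
represents `α` through the Killing form `κ`. -/
noncomputable def rootSqLength [FiniteDimensional ℝ L] [LieAlgebra.IsSemisimple ℝ L]
    {𝔞 : LieSubalgebra ℝ L} [𝔞.IsCartanSubalgebra] (α : 𝔞.root) : ℝ :=
  let Hα : 𝔞 := (LieAlgebra.IsKilling.cartanEquivDual 𝔞).symm (α : LieModule.Weight ℝ 𝔞 L)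
  killingForm ℝ L Hα Hα

/-- `x = X_α` is a root vector for `α` such that `κ(X_α, X_{-α}) = 2 / ⟨α, α⟩`,
where `X_{-α} = -θ X_α`. -/
structure IsNormalizedRootVector [FiniteDimensional ℝ L] [LieAlgebra.IsSemisimple ℝ L]
    (θ : L ≃ₗ⁅ℝ⁆ L) {𝔞 : LieSubalgebra ℝ L} [𝔞.IsCartanSubalgebra] (α : 𝔞.root) (x : L) :
    Prop where
  mem_rootSpace : x ∈ LieAlgebra.rootSpace 𝔞 (α : LieModule.Weight ℝ 𝔞 L)
  killingForm_eq : killingForm ℝ L x (-θ x) = 2 / rootSqLength α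

/-- For `x = X_α`, the element `A_α = X_α - X_{-α}`, where `X_{-α} = -θ X_α`. -/
def compactGenerator (θ : L ≃ₗ⁅ℝ⁆ L) (x : L) : L := x - -θ x

end Split

/-! ### Root strings and the brackets of the compact generators. -/

section SplitAlgebra

open LieAlgebra LieAlgebra.IsKilling LieModule

variable {L : Type*} [LieRing L] [LieAlgebra ℝ L] {θ : L ≃ₗ⁅ℝ⁆ L} {𝔞 : LieSubalgebra ℝ L} [𝔞.IsCartanSubalgebra]

/-! Write A = A_α and B = A_β. A simple edge makes both Cartan integers -1, so the α-string through
β is just β, β + α. The brackets of root vectors then give [A,[A,B]] = -B, and symmetrically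
[B,[B,A]] = -A (`lie_compactGenerator_lie_compactGenerator`): A, B and [A,B] satisfy the relations
of 𝔰𝔬(3). Since Ad(exp tA) has generator ad A (`IsMIntegralCurve.hasDerivAt_lieAd`), it rotates the
plane of B and [A,B] by the angle t. Hence Ad(s_α) sends B to [A,B], Ad(s_β) sends [A,B] to A, and
Ad(exp πA) sends B to -B. As g exp(v) g⁻¹ = exp(Ad(g) v) in G itself (`conj_lieExp`), these facts
lift to G for any G with this Lie algebra. The first identity says Ad(s_β s_α) B = A. For the
second, s_α exp(tB) s_α = exp(t[A,B]) exp(πA) with exp(t[A,B]) = s_β exp(-tA) s_β⁻¹, and s_β⁻¹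
exp(πA) = exp(πA) s_β (`lieExp_braid_relations`). -/

/-- A Cartan involution exchanges opposite root spaces. -/
theorem IsMaximalAbelianInNoncompactPart.map_mem_rootSpace_neg
    (h𝔞 : IsMaximalAbelianInNoncompactPart θ 𝔞)
    {χ : 𝔞 → ℝ} {x : L} (hx : x ∈ rootSpace 𝔞 χ) : θ x ∈ rootSpace 𝔞 (-χ) := by
  rw [rootSpace, mem_genWeightSpace] at hx ⊢
  intro h
  obtain ⟨k, hk⟩ := hx h
  refine ⟨k, ?_⟩
  -- As θ h = -h, the operators ad h + χ(h) and -(ad h - χ(h)) are intertwined by θ; the k-th power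
  -- only adds the sign (-1)^k, so generalized eigenspaces correspond.
  have hθh : ∀ y : L, ((toEnd ℝ 𝔞 L h) - ((-χ) h) • 1) (θ y) =
      θ (-((toEnd ℝ 𝔞 L h - (χ h) • 1) y)) := by
    intro y
    simp only [LinearMap.sub_apply, toEnd_apply_apply, LinearMap.smul_apply, Module.End.one_apply,
      Pi.neg_apply, LieSubalgebra.coe_bracket_of_module, map_neg, map_sub, LieEquiv.map_lie,
      h𝔞.prop.2 h h.2, map_smul, neg_lie, neg_smul, LinearMap.neg_apply]
    abel
  have hpow : ∀ (k : ℕ) (y : L), (((toEnd ℝ 𝔞 L h) - ((-χ) h) • 1) ^ k) (θ y) =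
      θ ((-1 : ℝ) ^ k • (((toEnd ℝ 𝔞 L h - (χ h) • 1) ^ k) y)) := by
    intro k
    induction k with
    | zero => simp
    | succ k ih =>
      intro y
      rw [pow_succ, Module.End.mul_apply, hθh, ih, pow_succ, pow_succ (_ - _), Module.End.mul_apply,
        map_neg, mul_neg_one, smul_neg, neg_smul]
  rw [hpow, hk, smul_zero, map_zero]

variable [FiniteDimensional ℝ L] [LieAlgebra.IsSemisimple ℝ L]
  (hθ : IsCartanInvolution θ) (h𝔞 : IsMaximalAbelianInNoncompactPart θ 𝔞)

/-- The two Cartan integers have product 1, so they are both 1 or both -1; distinct simple roots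
never pair positively. -/
theorem splitRootSystem_pairing_eq_neg_one_of_coxeterWeight_eq_one
    (S : (splitRootSystem hθ h𝔞).Base) {α β : 𝔞.root} (hα : α ∈ S.support) (hβ : β ∈ S.support)
    (hαβ : (splitRootSystem hθ h𝔞).coxeterWeight α β = 1) :
    (splitRootSystem hθ h𝔞).pairing α β = -1 := by
  have := h𝔞.isTriangularizable hθ
  have : (splitRootSystem hθ h𝔞).IsCrystallographic :=
    inferInstanceAs (rootSystem 𝔞).IsCrystallographic
  have hne : α ≠ β := by
    rintro rfl
    rw [RootPairing.coxeterWeight, RootPairing.pairing_same] at hαβ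
    norm_num at hαβ
  have h1 := S.pairingIn_le_zero_of_ne hne hα hβ
  have h2 := S.pairingIn_le_zero_of_ne hne.symm hβ hα
  rw [RootPairing.coxeterWeight, ← RootPairing.algebraMap_pairingIn _ ℤ,
    ← RootPairing.algebraMap_pairingIn _ ℤ] at hαβ
  rw [← RootPairing.algebraMap_pairingIn _ ℤ]
  simp only [algebraMap_int_eq, eq_intCast] at hαβ ⊢
  have h3 : (splitRootSystem hθ h𝔞).pairingIn ℤ α β * (splitRootSystem hθ h𝔞).pairingIn ℤ β α
    = 1 := by exact_mod_cast hαβ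
  rcases Int.mul_eq_one_iff_eq_one_or_neg_one.mp h3 with h | h
  · omega
  · exact_mod_cast h.1

/-- A linear functional on `𝔞` which is neither zero nor a root has trivial root space. -/
theorem eq_zero_of_mem_rootSpace_of_notMem_range_root {f : Module.Dual ℝ 𝔞} (hf0 : f ≠ 0)
    (hf : f ∉ Set.range (splitRootSystem hθ h𝔞).root) {x : L} (hx : x ∈ rootSpace 𝔞 f) :
    x = 0 := by
  have := h𝔞.isTriangularizable hθ
  by_contra hx0
  have hne : genWeightSpace L (f : 𝔞 → ℝ) ≠ ⊥ := by
    intro h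
    rw [rootSpace, h] at hx
    exact hx0 (by simpa using hx)
  refine hf ⟨⟨⟨f, hne⟩, ?_⟩, ?_⟩
  · simp only [LieSubalgebra.root, Finset.mem_filter, Finset.mem_univ, true_and]
    intro h
    exact hf0 (by ext y; exact congrFun h y)
  · ext y
    rfl

/-- The brackets of the compact generators of two simple roots joined by a simple edge. -/
theorem lie_compactGenerator_lie_compactGenerator
    (S : (splitRootSystem hθ h𝔞).Base) {α β : 𝔞.root} (hα : α ∈ S.support) (hβ : β ∈ S.support)
    (hαβ : (splitRootSystem hθ h𝔞).coxeterWeight α β = 1) {x y : L}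
    (hx : IsNormalizedRootVector θ α x) (hy : y ∈ rootSpace 𝔞 (β : Weight ℝ 𝔞 L)) :
    ⁅compactGenerator θ x, ⁅compactGenerator θ x, compactGenerator θ y⁆⁆ =
      -compactGenerator θ y := by
  have := h𝔞.isTriangularizable hθ
  have hp : (splitRootSystem hθ h𝔞).pairing β α = -1 := by
    refine splitRootSystem_pairing_eq_neg_one_of_coxeterWeight_eq_one hθ h𝔞 S hβ hα ?_
    rwa [RootPairing.coxeterWeight_swap]
  have hne : α ≠ β := by
    rintro rfl
    rw [RootPairing.pairing_same] at hp
    norm_num at hp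
  have hsub := S.sub_notMem_range_root hβ hα
  set P := splitRootSystem hθ h𝔞 with hP
  -- The reflection in α carries β + 2α to β - α, a difference of simple roots and so not a root.
  have hadd : P.root β + (2 : ℝ) • P.root α ∉ Set.range P.root := by
    rintro ⟨γ, hγ⟩
    refine hsub ⟨P.reflectionPerm α γ, ?_⟩
    rw [RootPairing.root_reflectionPerm, hγ, map_add, map_smul, RootPairing.reflection_apply_self,
      RootPairing.reflection_apply_root, hp]
    module
  have hadd0 : P.root β + (2 : ℝ) • P.root α ≠ 0 := by
    intro h
    have h' := congrArg (fun f ↦ P.toLinearMap f (P.coroot α)) h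
    simp only [map_add, map_smul, LinearMap.add_apply, LinearMap.smul_apply,
      RootPairing.root_coroot_eq_pairing, RootPairing.pairing_same, hp, map_zero,
      LinearMap.zero_apply] at h'
    norm_num at h'
  have hsub0 : P.root β - P.root α ≠ 0 := by
    intro h
    exact hne (P.root.injective (sub_eq_zero.mp h).symm)
  have hx' := hx.mem_rootSpace
  have hθx := h𝔞.map_mem_rootSpace_neg hx'
  have hθy := h𝔞.map_mem_rootSpace_neg hy
  have e1 : ⁅x, ⁅x, y⁆⁆ = 0 := by
    refine eq_zero_of_mem_rootSpace_of_notMem_range_root hθ h𝔞 hadd0 hadd ?_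
    have := lie_mem_genWeightSpace_of_mem_genWeightSpace hx'
      (lie_mem_genWeightSpace_of_mem_genWeightSpace hx' hy)
    convert! this using 1
    congr 1
    ext z
    change (β : Weight ℝ 𝔞 L) z + 2 * (α : Weight ℝ 𝔞 L) z = (α : Weight ℝ 𝔞 L) z +
      ((α : Weight ℝ 𝔞 L) z + (β : Weight ℝ 𝔞 L) z)
    ring
  have e2 : ⁅θ x, y⁆ = 0 := by
    refine eq_zero_of_mem_rootSpace_of_notMem_range_root hθ h𝔞 hsub0 hsub ?_
    have := lie_mem_genWeightSpace_of_mem_genWeightSpace hθx hy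
    convert! this using 1
    congr 1
    ext z
    change (β : Weight ℝ 𝔞 L) z - (α : Weight ℝ 𝔞 L) z = - (α : Weight ℝ 𝔞 L) z +
      (β : Weight ℝ 𝔞 L) z
    ring
  have e1' : ⁅θ x, ⁅θ x, θ y⁆⁆ = 0 := by simp [← LieEquiv.map_lie, e1]
  have e2' : ⁅x, θ y⁆ = 0 := by
    rw [← hθ.involutive x, ← LieEquiv.map_lie, e2, map_zero]
  -- The normalization of x enters here: 2/⟨α,α⟩ is the factor that turns the Killing dual H_α into
  -- the coroot, using ⟨α,α⟩ = α(H_α).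
  have hxx : ⁅x, θ x⁆ = -((coroot (α : Weight ℝ 𝔞 L) : 𝔞) : L) := by
    have h := lie_eq_killingForm_smul_of_mem_rootSpace_of_mem_rootSpace_neg hx' hθx
    have hk : killingForm ℝ L x (θ x) = -(2 / rootSqLength α) := by
      rw [← hx.killingForm_eq, map_neg, neg_neg]
    rw [h, hk, coroot]
    have hl : rootSqLength α = (α : Weight ℝ 𝔞 L)
        ((cartanEquivDual 𝔞).symm ((α : Weight ℝ 𝔞 L) : Module.Dual ℝ 𝔞)) := by
      unfold rootSqLength
      have := cartanEquivDual_apply_apply 𝔞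
        ((cartanEquivDual 𝔞).symm ((α : Weight ℝ 𝔞 L) : Module.Dual ℝ 𝔞))
        ((cartanEquivDual 𝔞).symm ((α : Weight ℝ 𝔞 L) : Module.Dual ℝ 𝔞))
      rw [LinearEquiv.apply_symm_apply] at this
      exact this.symm
    rw [hl]
    push_cast
    rw [← Nat.cast_smul_eq_nsmul ℝ, smul_smul, neg_smul]
    rfl
  have hβα : (β : Weight ℝ 𝔞 L) (coroot (α : Weight ℝ 𝔞 L)) = -1 := hp
  have e3 : ⁅⁅x, θ x⁆, y⁆ = y := by
    rw [hxx, neg_lie]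
    have := lie_eq_smul_of_mem_rootSpace hy (coroot (α : Weight ℝ 𝔞 L))
    rw [hβα, LieSubalgebra.coe_bracket_of_module] at this
    rw [this]; simp
  have e4 : ⁅⁅x, θ x⁆, θ y⁆ = -θ y := by
    rw [hxx, neg_lie]
    have := lie_eq_smul_of_mem_rootSpace hθy (coroot (α : Weight ℝ 𝔞 L))
    rw [Pi.neg_apply, hβα, LieSubalgebra.coe_bracket_of_module] at this
    rw [this]; simp
  have e5 : ⁅x, ⁅θ x, θ y⁆⁆ = -θ y := by rw [leibniz_lie, e4, e2']; simp
  have e6 : ⁅θ x, ⁅x, y⁆⁆ = -y := by rw [leibniz_lie, ← lie_skew (θ x) x, neg_lie, e3, e2]; simp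
  -- The mixed brackets vanish, so [A,B] = [x,y] + [θx,θy]; a second bracket leaves only [θx,[x,y]]
  -- = -y and [x,[θx,θy]] = -θy.
  simp only [compactGenerator, sub_neg_eq_add, add_lie, lie_add, e1, e1', e2, e2', e5, e6, add_zero, zero_add]
  abel

end SplitAlgebra

/-! ### One-parameter subgroups and the adjoint action. -/

section LieExp

variable {E : Type*} [NormedAddCommGroup E] [NormedSpace ℝ E]
  {G : Type*} [TopologicalSpace G] [ChartedSpace E G] [Group G]

/-- The adjoint action of a Lie group on its Lie algebra. -/
noncomputable def lieAd (g : G) : E →L[ℝ] E :=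
  mfderiv 𝓘(ℝ, E) 𝓘(ℝ, E) (fun x : G ↦ g * x * g⁻¹) 1

theorem lieAd_one : lieAd (E := E) (1 : G) = ContinuousLinearMap.id ℝ E := by
  unfold lieAd
  have : (fun x : G ↦ 1 * x * 1⁻¹) = id := by ext; simp
  rw [this]
  exact mfderiv_id

variable [LieGroup 𝓘(ℝ, E) (minSmoothness ℝ 3) G]

/-- An integral curve of a left-invariant vector field is determined by one of its values. -/
theorem isMIntegralCurve_mulInvariantVectorField_unique [FiniteDimensional ℝ E] [T2Space G]
    {v : GroupLieAlgebra 𝓘(ℝ, E) G} {γ γ' : ℝ → G}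
    (hγ : IsMIntegralCurve γ (mulInvariantVectorField v))
    (hγ' : IsMIntegralCurve γ' (mulInvariantVectorField v)) {t₀ : ℝ} (h : γ t₀ = γ' t₀) :
    γ = γ' := by
  have : IsManifold 𝓘(ℝ, E) 1 G :=
    IsManifold.of_le (n := minSmoothness ℝ 3) (by simp)
  have hv : CMDiff 1 (fun g : G ↦
      (mulInvariantVectorField v g : TangentBundle 𝓘(ℝ, E) G)) :=
    (contMDiff_mulInvariantVectorField v).of_le (by simp)
  exact isMIntegralCurve_Ioo_eq_of_contMDiff_boundaryless hv hγ hγ' h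

/-- Any integral curve through the identity is a one-parameter exponential curve. -/
theorem lieExp_smul_eq [FiniteDimensional ℝ E] [T2Space G]
    {v : GroupLieAlgebra 𝓘(ℝ, E) G} {γ : ℝ → G} (h0 : γ 0 = 1)
    (hγ : IsMIntegralCurve γ (mulInvariantVectorField v)) (t : ℝ) :
    lieExp (t • v) = γ t := by
  have hs := (exists_isMIntegralCurve_mulInvariantVectorField (t • v)).choose_spec
  have hγ' := hγ.comp_mul t
  rw [← mulInvariantVectorField_smul] at hγ'
  have := congrFun (isMIntegralCurve_mulInvariantVectorField_unique hs.2 hγ' (t₀ := 0)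
    (by simp [hs.1, h0])) 1
  simpa [lieExp] using this

theorem isMIntegralCurve_lieExp_smul [FiniteDimensional ℝ E] [T2Space G]
    (v : GroupLieAlgebra 𝓘(ℝ, E) G) :
    IsMIntegralCurve (fun t : ℝ ↦ lieExp (t • v)) (mulInvariantVectorField v) := by
  obtain ⟨γ, h0, hγ⟩ := exists_isMIntegralCurve_mulInvariantVectorField v
  simpa only [lieExp_smul_eq h0 hγ] using hγ

@[simp]
theorem lieExp_zero [FiniteDimensional ℝ E] [T2Space G] :
    lieExp (0 : GroupLieAlgebra 𝓘(ℝ, E) G) = 1 := by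
  obtain ⟨γ, h0, hγ⟩ := exists_isMIntegralCurve_mulInvariantVectorField
    (0 : GroupLieAlgebra 𝓘(ℝ, E) G)
  simpa [h0] using lieExp_smul_eq h0 hγ 0

theorem lieExp_add_smul [FiniteDimensional ℝ E] [T2Space G]
    (s t : ℝ) (v : GroupLieAlgebra 𝓘(ℝ, E) G) :
    lieExp ((s + t) • v) = lieExp (s • v) * lieExp (t • v) := by
  have h := isMIntegralCurve_lieExp_smul v
  have h1 : IsMIntegralCurve (fun t : ℝ ↦ lieExp (s • v) * lieExp (t • v))
      (mulInvariantVectorField v) := by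
    rw [isMIntegralCurve_iff_isMIntegralCurveOn] at h ⊢
    exact isMIntegralCurveOn_mul_left v _ h
  have := congrFun (isMIntegralCurve_mulInvariantVectorField_unique (h.comp_add s) h1 (t₀ := 0)
    (by simp)) t
  simpa [add_comm] using this

theorem lieExp_neg [FiniteDimensional ℝ E] [T2Space G] (v : GroupLieAlgebra 𝓘(ℝ, E) G) :
    lieExp (-v) = (lieExp v)⁻¹ := by
  have := lieExp_add_smul (-1) 1 v
  simp only [neg_add_cancel, zero_smul, lieExp_zero, neg_smul, one_smul] at this
  exact eq_inv_of_mul_eq_one_left this.symm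

theorem contMDiff_conj (g : G) :
    ContMDiff 𝓘(ℝ, E) 𝓘(ℝ, E) (minSmoothness ℝ 3) (fun x : G ↦ g * x * g⁻¹) :=
  (contMDiff_mul_right (I := 𝓘(ℝ, E)) (n := minSmoothness ℝ 3) (a := g⁻¹)).comp
    (contMDiff_mul_left (a := g))

theorem mdifferentiableAt_conj (g x : G) :
    MDifferentiableAt 𝓘(ℝ, E) 𝓘(ℝ, E) (fun x : G ↦ g * x * g⁻¹) x :=
  (contMDiff_conj g).contMDiffAt.mdifferentiableAt (by simp)

theorem mdifferentiableAt_mul_left' (g x : G) :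
    MDifferentiableAt 𝓘(ℝ, E) 𝓘(ℝ, E) (fun x : G ↦ g * x) x :=
  (contMDiff_mul_left (I := 𝓘(ℝ, E)) (n := minSmoothness ℝ 3)).contMDiffAt.mdifferentiableAt
    (by simp)

theorem lieAd_mul (g h : G) : lieAd (E := E) (g * h) = (lieAd g).comp (lieAd h) := by
  unfold lieAd
  have : (fun x : G ↦ g * h * x * (g * h)⁻¹) = (fun x ↦ g * x * g⁻¹) ∘ (fun x ↦ h * x * h⁻¹) := by
    ext; simp [mul_assoc]
  rw [this, mfderiv_comp (I' := 𝓘(ℝ, E)) _ (mdifferentiableAt_conj g _)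
    (mdifferentiableAt_conj h _)]
  change (mfderiv 𝓘(ℝ, E) 𝓘(ℝ, E) (fun x : G ↦ g * x * g⁻¹) (h * 1 * h⁻¹) : E →L[ℝ] E).comp _ = _
  rw [show h * 1 * h⁻¹ = 1 by simp]
  rfl

/-- Conjugation by g after left translation by x is left translation by gxg⁻¹ after conjugation;
differentiate this at 1. -/
theorem mfderiv_conj_mulInvariantVectorField (g x : G) (v : GroupLieAlgebra 𝓘(ℝ, E) G) :
    mfderiv 𝓘(ℝ, E) 𝓘(ℝ, E) (fun x : G ↦ g * x * g⁻¹) x (mulInvariantVectorField v x) =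
      mulInvariantVectorField (lieAd g v : E) (g * x * g⁻¹) := by
  unfold mulInvariantVectorField lieAd
  have h1 := mfderiv_comp (I' := 𝓘(ℝ, E)) (1 : G) (mdifferentiableAt_conj (E := E) g (x * 1))
    (mdifferentiableAt_mul_left' x 1)
  have h2 := mfderiv_comp (I' := 𝓘(ℝ, E)) (1 : G)
    (mdifferentiableAt_mul_left' (E := E) (g * x * g⁻¹) (g * 1 * g⁻¹))
    (mdifferentiableAt_conj g 1)
  have : (fun x : G ↦ g * x * g⁻¹) ∘ (fun y ↦ x * y) =
      (fun y ↦ g * x * g⁻¹ * y) ∘ (fun x ↦ g * x * g⁻¹) := by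
    ext; simp [mul_assoc]
  rw [this, h2] at h1
  have h3 := congrArg (fun f : E →L[ℝ] E ↦ f v) h1
  change (mfderiv 𝓘(ℝ, E) 𝓘(ℝ, E) (fun y : G ↦ g * x * g⁻¹ * y) (g * 1 * g⁻¹) : E →L[ℝ] E) _ =
    (mfderiv 𝓘(ℝ, E) 𝓘(ℝ, E) (fun x : G ↦ g * x * g⁻¹) (x * 1) : E →L[ℝ] E) _ at h3
  rw [show g * 1 * g⁻¹ = 1 by simp, mul_one x] at h3
  exact h3.symm

/-- The conjugated curve g exp(tv) g⁻¹ is an integral curve of the field of Ad(g) v through 1, and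
such curves are unique. -/
theorem conj_lieExp [FiniteDimensional ℝ E] [T2Space G] (g : G)
    (v : GroupLieAlgebra 𝓘(ℝ, E) G) :
    g * lieExp v * g⁻¹ = lieExp (G := G) (lieAd g v : E) := by
  have h : IsMIntegralCurve (fun t : ℝ ↦ g * lieExp (t • v) * g⁻¹)
      (mulInvariantVectorField (I := 𝓘(ℝ, E)) (lieAd g v : E)) := by
    intro t
    have := (mdifferentiableAt_conj (E := E) g (lieExp (t • v))).hasMFDerivAt.comp t
      (isMIntegralCurve_lieExp_smul v t)
    rw [← mfderiv_conj_mulInvariantVectorField]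
    have hlin : ((1 : ℝ →L[ℝ] ℝ).smulRight (mfderiv 𝓘(ℝ, E) 𝓘(ℝ, E) (fun x : G ↦ g * x * g⁻¹)
          (lieExp (t • v)) (mulInvariantVectorField v (lieExp (t • v)))) : ℝ →L[ℝ] E) =
        (mfderiv 𝓘(ℝ, E) 𝓘(ℝ, E) (fun x : G ↦ g * x * g⁻¹) (lieExp (t • v))).comp
          ((1 : ℝ →L[ℝ] ℝ).smulRight (mulInvariantVectorField v (lieExp (t • v)))) := by
      apply ContinuousLinearMap.ext
      intro r
      exact (map_smul (mfderiv 𝓘(ℝ, E) 𝓘(ℝ, E) (fun x : G ↦ g * x * g⁻¹) (lieExp (t • v))) _ _).symm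
    exact hlin ▸ this
  have := lieExp_smul_eq (by simp) h 1
  simp only [one_smul] at this
  exact this.symm.trans (congrArg lieExp (one_smul ℝ _))

end LieExp

/-! ### The derivative of Ad for a local group law. -/

section LocalGroup

open Filter Topology

variable {E : Type*} [NormedAddCommGroup E] [NormedSpace ℝ E]

theorem ContDiffAt.hasFDerivAt_fderiv_comp_apply {F E' : Type*} [NormedAddCommGroup F]
    [NormedSpace ℝ F] [NormedAddCommGroup E'] [NormedSpace ℝ E'] {m : F → E'} {u : E → F}
    {a : E → F} {u' a' : E →L[ℝ] F} {x : E} (hm : ContDiffAt ℝ 2 m (u x))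
    (hu : HasFDerivAt u u' x) (ha : HasFDerivAt a a' x) :
    HasFDerivAt (fun y ↦ fderiv ℝ m (u y) (a y))
      ((fderiv ℝ m (u x)).comp a' +
        ((fderiv ℝ (fderiv ℝ m) (u x)).comp u').flip (a x)) x := by
  have h : DifferentiableAt ℝ (fderiv ℝ m) (u x) :=
    (hm.fderiv_right (m := 1) (by norm_num)).differentiableAt (by norm_num)
  exact (h.hasFDerivAt.comp x hu).clm_apply ha

/-- For a local group law `m` on a vector space with unit `e` and conjugation `c`, the derivative
of the adjoint action is the commutator of the mixed second derivatives of `m`. -/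
theorem hasFDerivAt_fderiv_conj_of_local_mul {m c : E × E → E} {e : E}
    (hm : ContDiffAt ℝ 2 m (e, e)) (hc : ContDiffAt ℝ 2 c (e, e))
    (hml : ∀ᶠ x in 𝓝 e, m (x, e) = x) (hcr : ∀ᶠ x in 𝓝 e, c (x, e) = e)
    (hcl : ∀ᶠ y in 𝓝 e, c (e, y) = y)
    (hmc : ∀ᶠ p in 𝓝 (e, e), m (c p, p.1) = m p) (w : E) :
    ∃ a' : E →L[ℝ] E, HasFDerivAt (fun x ↦ fderiv ℝ c (x, e) (0, w)) a' e ∧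
      ∀ v, a' v = fderiv ℝ (fun x ↦ fderiv ℝ m (x, e) (0, w)) e v -
        fderiv ℝ (fun x ↦ fderiv ℝ m (x, e) (0, v)) e w := by
  have hl : HasFDerivAt (fun x : E ↦ (x, e)) (ContinuousLinearMap.inl ℝ E E) e :=
    hasFDerivAt_prodMk_left e e
  have hr : HasFDerivAt (fun x : E ↦ (e, x)) (ContinuousLinearMap.inr ℝ E E) e :=
    hasFDerivAt_prodMk_right e e
  have ha := hc.hasFDerivAt_fderiv_comp_apply (u := fun x ↦ (x, e)) hl
    (hasFDerivAt_const ((0, w) : E × E) e)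
  refine ⟨_, ha, fun v ↦ ?_⟩
  set a : E → E := fun x ↦ fderiv ℝ c (x, e) (0, w)
  set a' := (fderiv ℝ c (e, e)).comp (0 : E →L[ℝ] E × E) +
    ((fderiv ℝ (fderiv ℝ c) (e, e)).comp (ContinuousLinearMap.inl ℝ E E)).flip (0, w)
  have hb (u : E) := hm.hasFDerivAt_fderiv_comp_apply (u := fun x ↦ (x, e)) hl
    (hasFDerivAt_const ((0, u) : E × E) e)
  have hd := hm.hasFDerivAt_fderiv_comp_apply (u := fun x ↦ (e, x)) hr
    (a := fun x ↦ (a x, (0 : E))) (ha.prodMk (hasFDerivAt_const (0 : E) e))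
  have hae : a e = w := by
    have h1 := ((hc.differentiableAt (by norm_num)).hasFDerivAt.comp e hr)
    have h2 : HasFDerivAt (c ∘ fun x ↦ (e, x)) (ContinuousLinearMap.id ℝ E) e :=
      (hasFDerivAt_id e).congr_of_eventuallyEq hcl
    simpa using congrArg (fun f : E →L[ℝ] E ↦ f w) (h1.unique h2)
  have hme (u : E) : fderiv ℝ m (e, e) (u, 0) = u := by
    have h1 := HasFDerivAt.comp (f := fun x ↦ (x, e)) e
      (hm.differentiableAt (by norm_num)).hasFDerivAt hl
    have h2 : HasFDerivAt (m ∘ fun x ↦ (x, e)) (ContinuousLinearMap.id ℝ E) e :=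
      (hasFDerivAt_id e).congr_of_eventuallyEq hml
    simpa using congrArg (fun f : E →L[ℝ] E ↦ f u) (h1.unique h2)
  have hle : Tendsto (fun x : E ↦ (x, e)) (𝓝 e) (𝓝 (e, e)) := hl.continuousAt
  have hre : Tendsto (fun x : E ↦ (e, x)) (𝓝 e) (𝓝 (e, e)) := hr.continuousAt
  have hmd : ∀ᶠ p in 𝓝 (e, e), DifferentiableAt ℝ m p :=
    (hm.eventually (by norm_num)).mono fun p hp ↦ hp.differentiableAt (by norm_num)
  have hcd : ∀ᶠ p in 𝓝 (e, e), DifferentiableAt ℝ c p :=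
    (hc.eventually (by norm_num)).mono fun p hp ↦ hp.differentiableAt (by norm_num)
  -- Differentiate (x y x⁻¹) x = x y in y at e, for fixed x near e; the base point on the left is
  -- (c(x,e), x) = (e, x).
  have key : (fun x ↦ fderiv ℝ m (e, x) (a x, 0)) =ᶠ[𝓝 e]
      fun x ↦ fderiv ℝ m (x, e) (0, w) := by
    filter_upwards [hle.eventually hmc.eventually_nhds, hle.eventually hmd, hre.eventually hmd,
      hle.eventually hcd, hcr] with x h1 h2 h3 h4 h5
    have hrx : HasFDerivAt (fun y : E ↦ (x, y)) (ContinuousLinearMap.inr ℝ E E) e :=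
      hasFDerivAt_prodMk_right x e
    have h6 := h2.hasFDerivAt.comp e hrx
    have h7 : HasFDerivAt (fun y ↦ (c (x, y), x)) _ e :=
      (h4.hasFDerivAt.comp e hrx).prodMk (hasFDerivAt_const x e)
    have h8 := HasFDerivAt.comp (g := m) (g' := fderiv ℝ m (e, x)) e
      (by simpa only [h5] using h3.hasFDerivAt) h7
    have h9 : (m ∘ fun y ↦ (c (x, y), x)) =ᶠ[𝓝 e] (m ∘ fun y ↦ (x, y)) :=
      (hrx.continuousAt : Tendsto _ _ _).eventually h1
    simpa using congrArg (fun f : E →L[ℝ] E ↦ f w) ((h8.congr_of_eventuallyEq h9.symm).unique h6)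
  -- Differentiating `key` in x along v gives a'(v) + D²m((0,v),(w,0)) = D²m((v,0),(0,w)). Symmetry
  -- of D²m turns the middle term into the second term of the commutator.
  have h := congrArg (fun f : E →L[ℝ] E ↦ f v) ((hd.congr_of_eventuallyEq key.symm).unique (hb w))
  have hsymm : fderiv ℝ (fderiv ℝ m) (e, e) (0, v) (w, 0) =
      fderiv ℝ (fderiv ℝ m) (e, e) (w, 0) (0, v) :=
    hm.isSymmSndFDerivAt (by simp) _ _
  rw [(hb w).fderiv, (hb v).fderiv]
  simp [hae, hme] at h
  simp [← h, ← hsymm]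

end LocalGroup

/-! ### The derivative of Ad on a Lie group, computed in the chart at 1. -/

section Adjoint

open Filter Topology VectorField

variable {E : Type*} [NormedAddCommGroup E] [NormedSpace ℝ E]
  {G : Type*} [TopologicalSpace G] [ChartedSpace E G] [Group G]

variable (E G) in
/-- The coordinate of the identity in the preferred chart at the identity. -/
noncomputable def chartOne : E := extChartAt 𝓘(ℝ, E) (1 : G) 1

variable (E G) in
/-- The multiplication of a Lie group in the preferred chart at the identity. -/
noncomputable def chartMul (p : E × E) : E :=
  extChartAt 𝓘(ℝ, E) (1 : G)
    ((extChartAt 𝓘(ℝ, E) (1 : G)).symm p.1 * (extChartAt 𝓘(ℝ, E) (1 : G)).symm p.2)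

variable (E G) in
/-- The conjugation of a Lie group in the preferred chart at the identity. -/
noncomputable def chartConj (p : E × E) : E :=
  extChartAt 𝓘(ℝ, E) (1 : G)
    ((extChartAt 𝓘(ℝ, E) (1 : G)).symm p.1 * (extChartAt 𝓘(ℝ, E) (1 : G)).symm p.2 *
      ((extChartAt 𝓘(ℝ, E) (1 : G)).symm p.1)⁻¹)

@[simp]
theorem extChartAt_symm_chartOne : (extChartAt 𝓘(ℝ, E) (1 : G)).symm (chartOne E G) = 1 :=
  (extChartAt 𝓘(ℝ, E) (1 : G)).left_inv (mem_extChartAt_source _)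

theorem extChartAt_target_mem_nhds_chartOne :
    (extChartAt 𝓘(ℝ, E) (1 : G)).target ∈ 𝓝 (chartOne E G) :=
  extChartAt_target_mem_nhds (I := 𝓘(ℝ, E)) (1 : G)

theorem chartMul_right : ∀ᶠ x in 𝓝 (chartOne E G), chartMul E G (x, chartOne E G) = x := by
  filter_upwards [extChartAt_target_mem_nhds_chartOne] with x hx
  simp only [chartMul, extChartAt_symm_chartOne, mul_one,
    (extChartAt 𝓘(ℝ, E) (1 : G)).right_inv hx]

theorem chartConj_left : ∀ᶠ x in 𝓝 (chartOne E G), chartConj E G (chartOne E G, x) = x := by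
  filter_upwards [extChartAt_target_mem_nhds_chartOne] with x hx
  simp only [chartConj, extChartAt_symm_chartOne, inv_one, mul_one, one_mul,
    (extChartAt 𝓘(ℝ, E) (1 : G)).right_inv hx]

theorem chartConj_right (x : E) : chartConj E G (x, chartOne E G) = chartOne E G := by
  simp [chartConj, chartOne]

theorem two_le_minSmoothness_three : (2 : WithTop ℕ∞) ≤ minSmoothness ℝ 3 := by
  rw [minSmoothness_of_isRCLikeNormedField]
  norm_cast

theorem MDifferentiableAt.mfderiv_eq_fderiv {M N : Type*} [TopologicalSpace M] [ChartedSpace E M]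
    [TopologicalSpace N] [ChartedSpace E N] {f : M → N} {x : M}
    (hf : MDifferentiableAt 𝓘(ℝ, E) 𝓘(ℝ, E) f x) :
    mfderiv 𝓘(ℝ, E) 𝓘(ℝ, E) f x =
      fderiv ℝ (extChartAt 𝓘(ℝ, E) (f x) ∘ f ∘ (extChartAt 𝓘(ℝ, E) x).symm)
        (extChartAt 𝓘(ℝ, E) x x) := by
  have aux : ∀ (F : E → E) (D : E →L[ℝ] E) (z : E),
      HasFDerivWithinAt F D (Set.range 𝓘(ℝ, E)) z → D = fderiv ℝ F z := by
    intro F D z h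
    rw [ModelWithCorners.range_eq_univ, hasFDerivWithinAt_univ] at h
    exact h.fderiv.symm
  exact aux _ _ _ hf.hasMFDerivAt.2

theorem mulInvariantVectorField_one (v : GroupLieAlgebra 𝓘(ℝ, E) G) :
    mulInvariantVectorField v 1 = v := by
  have h : (fun x : G ↦ 1 * x) = id := by ext; simp
  have h1 : (mfderiv 𝓘(ℝ, E) 𝓘(ℝ, E) (fun x : G ↦ 1 * x) 1 : E →L[ℝ] E) =
      ContinuousLinearMap.id ℝ E := by
    rw [h]
    exact mfderiv_id
  exact congrArg (fun f : E →L[ℝ] E ↦ f v) h1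

theorem ContMDiffAt.contDiffAt_extChartAt_one_comp [IsManifold 𝓘(ℝ, E) (minSmoothness ℝ 3) G]
    {f : E × E → G} {p : E × E}
    (hf : ContMDiffAt 𝓘(ℝ, E × E) 𝓘(ℝ, E) (minSmoothness ℝ 3) f p) (hp : f p = 1) :
    ContDiffAt ℝ (minSmoothness ℝ 3) (fun q ↦ extChartAt 𝓘(ℝ, E) (1 : G) (f q)) p := by
  rw [← contMDiffAt_iff_contDiffAt]
  refine ContMDiffAt.comp (I' := 𝓘(ℝ, E)) p (g := extChartAt 𝓘(ℝ, E) (1 : G)) ?_ hf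
  rw [hp]
  exact contMDiffAt_extChartAt

variable [LieGroup 𝓘(ℝ, E) (minSmoothness ℝ 3) G]


theorem contMDiffAt_extChartAt_symm_chartOne :
    ContMDiffAt 𝓘(ℝ, E) 𝓘(ℝ, E) (minSmoothness ℝ 3) (extChartAt 𝓘(ℝ, E) (1 : G)).symm
      (chartOne E G) :=
  (contMDiffOn_extChartAt_symm (1 : G)).contMDiffAt extChartAt_target_mem_nhds_chartOne

theorem contMDiffAt_extChartAt_symm_fst :
    ContMDiffAt 𝓘(ℝ, E × E) 𝓘(ℝ, E) (minSmoothness ℝ 3)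
      (fun p : E × E ↦ (extChartAt 𝓘(ℝ, E) (1 : G)).symm p.1) (chartOne E G, chartOne E G) :=
  ContMDiffAt.comp (I' := 𝓘(ℝ, E)) (f := Prod.fst) (chartOne E G, chartOne E G)
    contMDiffAt_extChartAt_symm_chartOne
    contDiffAt_fst.contMDiffAt

theorem contMDiffAt_extChartAt_symm_snd :
    ContMDiffAt 𝓘(ℝ, E × E) 𝓘(ℝ, E) (minSmoothness ℝ 3)
      (fun p : E × E ↦ (extChartAt 𝓘(ℝ, E) (1 : G)).symm p.2) (chartOne E G, chartOne E G) :=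
  ContMDiffAt.comp (I' := 𝓘(ℝ, E)) (f := Prod.snd) (chartOne E G, chartOne E G)
    contMDiffAt_extChartAt_symm_chartOne
    contDiffAt_snd.contMDiffAt

theorem contDiffAt_chartMul :
    ContDiffAt ℝ (minSmoothness ℝ 3) (chartMul E G) (chartOne E G, chartOne E G) :=
  (contMDiffAt_extChartAt_symm_fst.mul contMDiffAt_extChartAt_symm_snd)
    |>.contDiffAt_extChartAt_one_comp
      (by simp only [Pi.mul_apply, extChartAt_symm_chartOne, mul_one])

theorem contDiffAt_chartConj :
    ContDiffAt ℝ (minSmoothness ℝ 3) (chartConj E G) (chartOne E G, chartOne E G) :=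
  ((contMDiffAt_extChartAt_symm_fst.mul contMDiffAt_extChartAt_symm_snd).mul
    contMDiffAt_extChartAt_symm_fst.inv)
    |>.contDiffAt_extChartAt_one_comp
      (by simp only [Pi.mul_apply, extChartAt_symm_chartOne, mul_one, inv_one])

/-- This is (x y x⁻¹) x = x y, valid where x y x⁻¹ stays in the chart domain, so that the chart and
its inverse cancel. -/
theorem chartMul_chartConj : ∀ᶠ p in 𝓝 (chartOne E G, chartOne E G),
    chartMul E G (chartConj E G p, p.1) = chartMul E G p := by
  have h := ((contMDiffAt_extChartAt_symm_fst.mul contMDiffAt_extChartAt_symm_snd).mul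
    (contMDiffAt_extChartAt_symm_fst (E := E) (G := G)).inv).continuousAt
  have hs : (extChartAt 𝓘(ℝ, E) (1 : G)).source ∈ 𝓝 (1 : G) := extChartAt_source_mem_nhds _
  filter_upwards [h.preimage_mem_nhds (by
    simpa only [Pi.mul_apply, extChartAt_symm_chartOne, mul_one, inv_one] using hs)] with p hp
  simp only [chartMul, chartConj]
  rw [(extChartAt 𝓘(ℝ, E) (1 : G)).left_inv (x := _ * _ * _⁻¹) hp]
  simp

/-- The adjoint action in the preferred chart at the identity. -/
theorem lieAd_extChartAt_symm : ∀ᶠ x in 𝓝 (chartOne E G), ∀ w : E,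
    lieAd ((extChartAt 𝓘(ℝ, E) (1 : G)).symm x) w =
      fderiv ℝ (chartConj E G) (x, chartOne E G) (0, w) := by
  have h1 : ∀ᶠ p in 𝓝 (chartOne E G, chartOne E G), DifferentiableAt ℝ (chartConj E G) p :=
    ((contDiffAt_chartConj.of_le two_le_minSmoothness_three).eventually (by norm_num)).mono
      fun p hp ↦ hp.differentiableAt (by norm_num)
  have hle : Tendsto (fun x : E ↦ (x, chartOne E G)) (𝓝 (chartOne E G))
    (𝓝 (chartOne E G, chartOne E G)) := (Continuous.prodMk_left _).continuousAt
  filter_upwards [hle.eventually h1] with x hx w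
  have h2 : HasFDerivAt (fun y ↦ chartConj E G (x, y)) _ (chartOne E G) :=
    hx.hasFDerivAt.comp (chartOne E G) (hasFDerivAt_prodMk_right x (chartOne E G))
  set g := (extChartAt 𝓘(ℝ, E) (1 : G)).symm x with hg
  have h3 : lieAd g = fderiv ℝ (fun y ↦ chartConj E G (x, y)) (chartOne E G) := by
    -- The derivative is read in the chart at g·1·g⁻¹, which equals 1 only propositionally; hence
    -- the generalization to z.
    have : ∀ z : G, z = 1 → fderiv ℝ (extChartAt 𝓘(ℝ, E) z ∘ (fun x : G ↦ g * x * g⁻¹) ∘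
        (extChartAt 𝓘(ℝ, E) (1 : G)).symm) (extChartAt 𝓘(ℝ, E) (1 : G) 1) =
        fderiv ℝ (fun y ↦ chartConj E G (x, y)) (chartOne E G) := by
      rintro z rfl
      rfl
    exact (mdifferentiableAt_conj g 1).mfderiv_eq_fderiv.trans (this _ (by simp))
  rw [h3, h2.fderiv]
  simp

/-- The left-invariant vector fields in the preferred chart at the identity. -/
theorem mpullbackWithin_extChartAt_symm_mulInvariantVectorField
    (v : GroupLieAlgebra 𝓘(ℝ, E) G) :
    mpullbackWithin 𝓘(ℝ, E) 𝓘(ℝ, E) (extChartAt 𝓘(ℝ, E) (1 : G)).symm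
      (mulInvariantVectorField v) Set.univ =ᶠ[𝓝 (chartOne E G)]
      fun x ↦ fderiv ℝ (chartMul E G) (x, chartOne E G) (0, v) := by
  have : IsManifold 𝓘(ℝ, E) 1 G :=
    IsManifold.of_le (n := minSmoothness ℝ 3) (by simp)
  have h1 : ∀ᶠ p in 𝓝 (chartOne E G, chartOne E G), DifferentiableAt ℝ (chartMul E G) p :=
    ((contDiffAt_chartMul.of_le two_le_minSmoothness_three).eventually (by norm_num)).mono
      fun p hp ↦ hp.differentiableAt (by norm_num)
  have hle : Tendsto (fun x : E ↦ (x, chartOne E G)) (𝓝 (chartOne E G))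
    (𝓝 (chartOne E G, chartOne E G)) := (Continuous.prodMk_left _).continuousAt
  filter_upwards [hle.eventually h1, extChartAt_target_mem_nhds_chartOne] with x hx hxt
  have h2 : HasFDerivAt (fun y ↦ chartMul E G (x, y)) _ (chartOne E G) :=
    hx.hasFDerivAt.comp (chartOne E G) (hasFDerivAt_prodMk_right x (chartOne E G))
  set g := (extChartAt 𝓘(ℝ, E) (1 : G)).symm x with hg
  have hgs : g ∈ (extChartAt 𝓘(ℝ, E) (1 : G)).source :=
    (extChartAt 𝓘(ℝ, E) (1 : G)).map_target hxt
  have hφ : MDifferentiableAt 𝓘(ℝ, E) 𝓘(ℝ, E) (extChartAt 𝓘(ℝ, E) (1 : G)) (g * 1) := by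
    rw [mul_one]
    exact mdifferentiableAt_extChartAt (by rwa [← extChartAt_source 𝓘(ℝ, E)])
  have hL := mdifferentiableAt_mul_left' (E := E) g 1
  have h3 : mfderiv 𝓘(ℝ, E) 𝓘(ℝ, E) (extChartAt 𝓘(ℝ, E) (1 : G) ∘ fun y ↦ g * y) 1 =
      fderiv ℝ (fun y ↦ chartMul E G (x, y)) (chartOne E G) :=
    (hφ.comp (1 : G) hL).mfderiv_eq_fderiv
  rw [mfderiv_comp (I' := 𝓘(ℝ, E)) _ hφ hL, h2.fderiv] at h3
  have h4 : (mfderivWithin 𝓘(ℝ, E) 𝓘(ℝ, E) (extChartAt 𝓘(ℝ, E) (1 : G)).symm Set.univ x).inverse =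
      mfderiv 𝓘(ℝ, E) 𝓘(ℝ, E) (extChartAt 𝓘(ℝ, E) (1 : G)) g := by
    rw [← ModelWithCorners.range_eq_univ 𝓘(ℝ, E)]
    exact ContinuousLinearMap.inverse_eq
      (mfderivWithin_extChartAt_symm_comp_mfderiv_extChartAt hxt)
      (mfderiv_extChartAt_comp_mfderivWithin_extChartAt_symm hxt)
  rw [mpullbackWithin_apply, h4]
  have h5 := congrArg (fun f : E →L[ℝ] E ↦ f v) h3
  change (mfderiv 𝓘(ℝ, E) 𝓘(ℝ, E) (extChartAt 𝓘(ℝ, E) (1 : G)) (g * 1) : E →L[ℝ] E) _ =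
    fderiv ℝ (chartMul E G) (x, chartOne E G) (0, v) at h5
  rw [mul_one g] at h5
  exact h5

/-- The Lie bracket in the preferred chart at the identity. -/
theorem lie_eq_fderiv_chartMul (v w : E) :
    (Bracket.bracket (L := GroupLieAlgebra 𝓘(ℝ, E) G) (M := GroupLieAlgebra 𝓘(ℝ, E) G) v w) = fderiv ℝ (fun x ↦ fderiv ℝ (chartMul E G) (x, chartOne E G) (0, w)) (chartOne E G) v -
      fderiv ℝ (fun x ↦ fderiv ℝ (chartMul E G) (x, chartOne E G) (0, v)) (chartOne E G) w := by
  have : IsManifold 𝓘(ℝ, E) 1 G :=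
    IsManifold.of_le (n := minSmoothness ℝ 3) (by simp)
  have hme (u : E) : fderiv ℝ (chartMul E G) (chartOne E G, chartOne E G) (0, u) = u := by
    have hr : HasFDerivAt (fun x : E ↦ (chartOne E G, x)) (ContinuousLinearMap.inr ℝ E E)
      (chartOne E G) := hasFDerivAt_prodMk_right _ _
    have h1 := (contDiffAt_chartMul.differentiableAt (by simp)).hasFDerivAt.comp (chartOne E G) hr
    have h2 : HasFDerivAt (chartMul E G ∘ fun x ↦ (chartOne E G, x)) (ContinuousLinearMap.id ℝ E)
        (chartOne E G) := by
      refine (hasFDerivAt_id _).congr_of_eventuallyEq ?_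
      filter_upwards [extChartAt_target_mem_nhds_chartOne] with x hx
      change chartMul E G (chartOne E G, x) = x
      simp only [chartMul, extChartAt_symm_chartOne, one_mul,
    (extChartAt 𝓘(ℝ, E) (1 : G)).right_inv hx]
    simpa using congrArg (fun f : E →L[ℝ] E ↦ f u) (h1.unique h2)
  have hdef (v w : GroupLieAlgebra 𝓘(ℝ, E) G) : ⁅v, w⁆ = ContinuousLinearMap.id ℝ E
      (lieBracketWithin ℝ
        (mpullbackWithin 𝓘(ℝ, E) 𝓘(ℝ, E) (extChartAt 𝓘(ℝ, E) (1 : G)).symm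
          (mulInvariantVectorField v) Set.univ)
        (mpullbackWithin 𝓘(ℝ, E) 𝓘(ℝ, E) (extChartAt 𝓘(ℝ, E) (1 : G)).symm
          (mulInvariantVectorField w) Set.univ) Set.univ (chartOne E G)) := by
    rw [GroupLieAlgebra.bracket_def, ← mlieBracketWithin_univ, mlieBracketWithin_apply,
      mfderiv_extChartAt_self]
    have hid : (ContinuousLinearMap.id ℝ E).inverse = ContinuousLinearMap.id ℝ E :=
      ContinuousLinearMap.inverse_id
    change (ContinuousLinearMap.id ℝ E).inverse _ = _
    rw [hid, ModelWithCorners.range_eq_univ, Set.preimage_univ, Set.univ_inter]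
    rfl
  have aux (V W : E → E) (z : E) : ContinuousLinearMap.id ℝ E (lieBracketWithin ℝ V W Set.univ z) =
      lieBracket ℝ V W z := by
    rw [lieBracketWithin_univ]
    rfl
  -- The bracket at a point depends only on germs, so the pulled-back fields may be replaced by x ↦
  -- Dm(x,e)(0,·), whose values at e are v and w by `hme`.
  have key := (mpullbackWithin_extChartAt_symm_mulInvariantVectorField (G := G) v).lieBracket_vectorField_eq
    (𝕜 := ℝ) (mpullbackWithin_extChartAt_symm_mulInvariantVectorField (G := G) w)
  refine (hdef _ _).trans <| (aux _ _ _).trans (key.trans ?_)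
  simp only [lieBracket_eq, hme]

/-- The chart at 1 has identity derivative at 1, so the coordinate velocity there is v itself. -/
theorem IsMIntegralCurve.hasDerivAt_extChartAt_one_comp {v : GroupLieAlgebra 𝓘(ℝ, E) G}
    {γ : ℝ → G} (h0 : γ 0 = 1) (hγ : IsMIntegralCurve γ (mulInvariantVectorField v)) :
    HasDerivAt (F := E) (fun t ↦ extChartAt 𝓘(ℝ, E) (1 : G) (γ t)) v 0 := by
  have : IsManifold 𝓘(ℝ, E) 1 G :=
    IsManifold.of_le (n := minSmoothness ℝ 3) (by simp)
  have hφ : MDifferentiableAt 𝓘(ℝ, E) 𝓘(ℝ, E) (extChartAt 𝓘(ℝ, E) (1 : G)) (γ 0) := by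
    rw [h0]
    exact mdifferentiableAt_extChartAt (mem_chart_source _ _)
  have aux : ∀ (F : ℝ → E) (D : E →L[ℝ] E) (V : E), D V = v →
      HasFDerivAt F (D.comp ((1 : ℝ →L[ℝ] ℝ).smulRight V)) 0 → HasDerivAt (F := E) F v 0 := by
    intro F D V hD h
    refine h.hasDerivAt.congr_deriv ?_
    simpa using hD
  have h1 : ∀ g : G, g = 1 → (mfderiv 𝓘(ℝ, E) 𝓘(ℝ, E) (extChartAt 𝓘(ℝ, E) (1 : G)) g)
      (mulInvariantVectorField v g) = v := by
    rintro g rfl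
    rw [mfderiv_extChartAt_self]
    exact mulInvariantVectorField_one v
  exact aux _ _ _ (h1 _ h0) (hφ.hasMFDerivAt.comp (0 : ℝ) (hγ 0)).hasFDerivAt

/-- The derivative of the adjoint action along an integral curve of a left-invariant vector field
is the bracket. -/
theorem IsMIntegralCurve.hasDerivAt_lieAd {v w u : E} {γ : ℝ → G} (h0 : γ 0 = 1)
    (hγ : IsMIntegralCurve γ (mulInvariantVectorField (I := 𝓘(ℝ, E)) (G := G) v))
    (hvw : Bracket.bracket (L := GroupLieAlgebra 𝓘(ℝ, E) G) (M := GroupLieAlgebra 𝓘(ℝ, E) G) v w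
      = u) :
    HasDerivAt (fun t : ℝ ↦ lieAd (E := E) (γ t) w) u 0 := by
  obtain ⟨a', ha, hav⟩ := hasFDerivAt_fderiv_conj_of_local_mul
    (contDiffAt_chartMul.of_le two_le_minSmoothness_three)
    (contDiffAt_chartConj.of_le two_le_minSmoothness_three) chartMul_right
    (.of_forall chartConj_right) chartConj_left (chartMul_chartConj (E := E) (G := G)) w
  have hu := hγ.hasDerivAt_extChartAt_one_comp h0
  have h1 : extChartAt 𝓘(ℝ, E) (1 : G) (γ 0) = chartOne E G := by rw [h0, chartOne]
  have hev : (fun t : ℝ ↦ lieAd (E := E) (γ t) w) =ᶠ[𝓝 0]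
      fun t ↦ fderiv ℝ (chartConj E G) (extChartAt 𝓘(ℝ, E) (1 : G) (γ t), chartOne E G)
        (0, w) := by
    have hs : (extChartAt 𝓘(ℝ, E) (1 : G)).source ∈ 𝓝 (γ 0) := by
      rw [h0]
      exact extChartAt_source_mem_nhds _
    have h2 := hu.continuousAt
    rw [ContinuousAt, h1] at h2
    filter_upwards [h2.eventually (lieAd_extChartAt_symm (E := E) (G := G)),
      (hγ 0).continuousAt.preimage_mem_nhds hs] with t ht hts
    rw [← ht w, (extChartAt 𝓘(ℝ, E) (1 : G)).left_inv hts]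
  refine HasDerivAt.congr_of_eventuallyEq ?_ hev
  have ha' : HasFDerivAt (fun x ↦ fderiv ℝ (chartConj E G) (x, chartOne E G) (0, w)) a'
      (extChartAt 𝓘(ℝ, E) (1 : G) (γ 0)) := by
    rw [h1]
    exact ha
  exact (HasFDerivAt.comp_hasDerivAt
    (l := fun x ↦ fderiv ℝ (chartConj E G) (x, chartOne E G) (0, w)) (0 : ℝ) ha' hu).congr_deriv
    ((hav v).trans ((lie_eq_fderiv_chartMul v w).symm.trans hvw))

end Adjoint

/-! ### Operator groups acting by rotations. -/

section Rotation

variable {E : Type*} [NormedAddCommGroup E] [NormedSpace ℝ E]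

/-- A one-parameter group of operators whose generator rotates the plane of `B` and `C` acts on
this plane by rotations. -/
theorem oneParameterGroup_apply_eq_rotation {T : ℝ → E →L[ℝ] E}
    (hadd : ∀ s t, T (s + t) = (T s).comp (T t)) (h0 : T 0 = ContinuousLinearMap.id ℝ E) {B C : E}
    (hB : HasDerivAt (fun t ↦ T t B) C 0) (hC : HasDerivAt (fun t ↦ T t C) (-B) 0) (t : ℝ) :
    T t B = Real.cos t • B + Real.sin t • C ∧ T t C = Real.cos t • C - Real.sin t • B := by
  -- Writing T s = T t ∘ T (s - t) transports the derivative at 0 to every t.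
  have hderiv {X Y : E} (h : HasDerivAt (fun t ↦ T t X) Y 0) (t : ℝ) :
      HasDerivAt (fun s ↦ T s X) (T t Y) t := by
    have h1 : HasDerivAt (fun s ↦ T (s - t) X) Y t :=
      HasDerivAt.comp_sub_const (f := fun s ↦ T s X) t t (by simpa using h)
    have h2 := (T t).hasFDerivAt.comp_hasDerivAt t h1
    refine h2.congr_of_eventuallyEq (.of_forall fun s ↦ ?_)
    change T s X = T t (T (s - t) X)
    rw [← ContinuousLinearMap.comp_apply, ← hadd, add_sub_cancel]
  have hconst {F : ℝ → E} (hF : ∀ t, HasDerivAt F 0 t) : F t = F 0 :=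
    is_const_of_deriv_eq_zero (fun t ↦ (hF t).differentiableAt) (fun t ↦ (hF t).deriv) t 0
  -- Rotating back T t B and T t C gives quantities with zero derivative. The rotation is then
  -- inverted with cos² + sin² = 1.
  have h1 : Real.cos t • T t B - Real.sin t • T t C = B := by
    refine (hconst (F := fun t ↦ Real.cos t • T t B - Real.sin t • T t C) fun t ↦ ?_).trans ?_
    · refine (((Real.hasDerivAt_cos t).smul (hderiv hB t)).sub
        ((Real.hasDerivAt_sin t).smul (hderiv hC t))).congr_deriv ?_
      rw [map_neg]
      module
    · simp [h0]
  have h2 : Real.sin t • T t B + Real.cos t • T t C = C := by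
    refine (hconst (F := fun t ↦ Real.sin t • T t B + Real.cos t • T t C) fun t ↦ ?_).trans ?_
    · refine (((Real.hasDerivAt_sin t).smul (hderiv hB t)).add
        ((Real.hasDerivAt_cos t).smul (hderiv hC t))).congr_deriv ?_
      rw [map_neg]
      module
    · simp [h0]
  have h3 := Real.cos_sq_add_sin_sq t
  constructor
  · linear_combination (norm := module) Real.cos t • h1 + Real.sin t • h2 - h3 • T t B
  · linear_combination (norm := module) Real.cos t • h2 - Real.sin t • h1 - h3 • T t C

end Rotation

/-! ### The braid relations in the group. -/

section BraidRelations

variable {E : Type*} [NormedAddCommGroup E] [NormedSpace ℝ E] [FiniteDimensional ℝ E]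
  {G : Type*} [TopologicalSpace G] [T2Space G] [ChartedSpace E G] [Group G]
  [LieGroup 𝓘(ℝ, E) (minSmoothness ℝ 3) G]

theorem lieAd_lieExp_smul_eq_rotation {A B C : GroupLieAlgebra 𝓘(ℝ, E) G} (hB : ⁅A, B⁆ = C)
    (hC : ⁅A, C⁆ = -B) (t : ℝ) :
    lieAd (E := E) (lieExp (t • A)) B = Real.cos t • B + Real.sin t • C ∧
      lieAd (E := E) (lieExp (t • A)) C = Real.cos t • C - Real.sin t • B := by
  have h0 : lieExp ((0 : ℝ) • A) = 1 := by simp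
  have hA := isMIntegralCurve_lieExp_smul A
  have h1 := IsMIntegralCurve.hasDerivAt_lieAd (E := E) (v := A) (w := B) (u := C) h0 hA hB
  have h2 := IsMIntegralCurve.hasDerivAt_lieAd (E := E) (v := A) (w := C) (u := -(show E from B)) h0 hA hC
  exact oneParameterGroup_apply_eq_rotation (E := E) (T := fun t ↦ lieAd (E := E) (lieExp (t • A)))
    (fun s t ↦ by rw [lieExp_add_smul, lieAd_mul]) (by rw [h0, lieAd_one])
    h1 h2 t

theorem conj_lieExp_smul {g : G} {v w : GroupLieAlgebra 𝓘(ℝ, E) G} (h : lieAd (E := E) g v = w)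
    (t : ℝ) : g * lieExp (t • v) * g⁻¹ = lieExp (t • w) := by
  rw [conj_lieExp]
  congr 1
  exact ((lieAd (E := E) g).map_smul t v).trans (congrArg (t • ·) h)

/-- Braid relations for the one-parameter subgroups of two elements which generate a copy of
`𝔰𝔬(3)`. -/
theorem lieExp_braid_relations {A B : GroupLieAlgebra 𝓘(ℝ, E) G} (hAB : ⁅A, ⁅A, B⁆⁆ = -B)
    (hBA : ⁅B, ⁅B, A⁆⁆ = -A) (t : ℝ) :
    lieExp (t • A) * lieExp ((Real.pi / 2) • B) * lieExp ((Real.pi / 2) • A) =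
        lieExp ((Real.pi / 2) • B) * lieExp ((Real.pi / 2) • A) * lieExp (t • B) ∧
      lieExp ((Real.pi / 2) • A) * lieExp (t • B) * lieExp ((Real.pi / 2) • A) =
        lieExp ((Real.pi / 2) • B) * lieExp ((Real.pi - t) • A) *
          lieExp ((Real.pi / 2) • B) := by
  have hpos (x y : E) : (0 : ℝ) • x + (1 : ℝ) • y = y := by module
  have hneg (x y : E) : (0 : ℝ) • x - (1 : ℝ) • y = -y := by module
  have hneg' (x y : E) : (-1 : ℝ) • x + (0 : ℝ) • y = -x := by module
  have hB : lieAd (E := E) (lieExp ((Real.pi / 2) • A)) B = ⁅A, B⁆ := by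
    have := (lieAd_lieExp_smul_eq_rotation rfl hAB (Real.pi / 2)).1
    rw [Real.cos_pi_div_two, Real.sin_pi_div_two] at this
    exact this.trans (hpos _ _)
  have hBpi : lieAd (E := E) (lieExp (Real.pi • A)) B = -B := by
    have := (lieAd_lieExp_smul_eq_rotation rfl hAB Real.pi).1
    rw [Real.cos_pi, Real.sin_pi] at this
    exact this.trans (hneg' _ _)
  have hA : lieAd (E := E) (lieExp ((Real.pi / 2) • B)) A = ⁅B, A⁆ := by
    have := (lieAd_lieExp_smul_eq_rotation rfl hBA (Real.pi / 2)).1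
    rw [Real.cos_pi_div_two, Real.sin_pi_div_two] at this
    exact this.trans (hpos _ _)
  have hC : lieAd (E := E) (lieExp ((Real.pi / 2) • B))
      (⁅B, A⁆ : GroupLieAlgebra 𝓘(ℝ, E) G) = -A := by
    have := (lieAd_lieExp_smul_eq_rotation rfl hBA (Real.pi / 2)).2
    rw [Real.cos_pi_div_two, Real.sin_pi_div_two] at this
    exact this.trans (hneg _ _)
  have e1 := conj_lieExp_smul hB
  have e2 := conj_lieExp_smul hA
  have e3 := conj_lieExp_smul hBpi
  have e4 := conj_lieExp_smul hC
  have hpi : lieExp (Real.pi • A) = lieExp ((Real.pi / 2) • A) * lieExp ((Real.pi / 2) • A) := by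
    rw [← lieExp_add_smul, add_halves]
  -- Everything is expressed through [B,A], so that the conjugation formulas for s_α and s_β can be
  -- chained.
  have hskew (s : ℝ) : s • ⁅A, B⁆ = (-s) • ⁅B, A⁆ := by rw [← lie_skew A B]; module
  have hskew' (s : ℝ) : s • (-B) = (-s) • B := by module
  have hskew'' (s : ℝ) : s • (-A) = (-s) • A := by module
  simp only [hskew, hskew', hskew''] at e1 e3 e4
  -- Conjugation by exp(πA) inverts s_β, because Ad(exp πA) B = -B.
  have e5 : lieExp (Real.pi • A) =
      lieExp ((Real.pi / 2) • B) * lieExp (Real.pi • A) * lieExp ((Real.pi / 2) • B) := by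
    have h := e3 (-(Real.pi / 2))
    rw [neg_neg, neg_smul, lieExp_neg] at h
    calc lieExp (Real.pi • A) = (lieExp (Real.pi • A) * (lieExp ((Real.pi / 2) • B))⁻¹ *
          (lieExp (Real.pi • A))⁻¹) * lieExp (Real.pi • A) * lieExp ((Real.pi / 2) • B) := by group
      _ = _ := by rw [h]
  constructor
  · have h := e4 (-t)
    rw [neg_neg, ← e1] at h
    rw [← h]
    group
  · have h1 : lieExp ((Real.pi / 2) • A) * lieExp (t • B) * lieExp ((Real.pi / 2) • A) =
        lieExp (-t • ⁅B, A⁆) * lieExp (Real.pi • A) := by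
      rw [← e1, hpi]
      group
    have h2 : lieExp ((Real.pi - t) • A) = lieExp (-t • A) * lieExp (Real.pi • A) := by
      rw [← lieExp_add_smul, sub_eq_neg_add]
    rw [h1, h2, ← e2]
    -- Only the factor exp(πA) on the left is expanded; its leading s_β cancels the s_β⁻¹ produced
    -- by `e2`.
    nth_rw 1 [e5]
    group

end BraidRelations

theorem mainTheorem11
    {E : Type*} [NormedAddCommGroup E] [NormedSpace ℝ E] [FiniteDimensional ℝ E]
    {G : Type*} [TopologicalSpace G] [T2Space G] [ChartedSpace E G] [Group G]
    [LieGroup 𝓘(ℝ, E) (minSmoothness ℝ 3) G]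
    [LieAlgebra.IsSemisimple ℝ (GroupLieAlgebra 𝓘(ℝ, E) G)]
    (θ : GroupLieAlgebra 𝓘(ℝ, E) G ≃ₗ⁅ℝ⁆ GroupLieAlgebra 𝓘(ℝ, E) G) (hθ : IsCartanInvolution θ)
    (𝔞 : LieSubalgebra ℝ (GroupLieAlgebra 𝓘(ℝ, E) G)) [𝔞.IsCartanSubalgebra]
    (h𝔞 : IsMaximalAbelianInNoncompactPart θ 𝔞)
    (S : (splitRootSystem hθ h𝔞).Base)
    (α β : 𝔞.root) (hα : α ∈ S.support) (hβ : β ∈ S.support)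
    (hαβ : (splitRootSystem hθ h𝔞).coxeterWeight α β = 1)
    (Xα Xβ : GroupLieAlgebra 𝓘(ℝ, E) G)
    (hXα : IsNormalizedRootVector θ α Xα) (hXβ : IsNormalizedRootVector θ β Xβ)
    (t : ℝ) (ht : t ∈ Set.Icc 0 Real.pi) :
    let Aα := compactGenerator θ Xα
    let Aβ := compactGenerator θ Xβ
    let sα : G := lieExp ((Real.pi / 2) • Aα)
    let sβ : G := lieExp ((Real.pi / 2) • Aβ)
    lieExp (t • Aα) * sβ * sα = sβ * sα * lieExp (t • Aβ) ∧
      sα * lieExp (t • Aβ) * sα = sβ * lieExp ((Real.pi - t) • Aα) * sβ := by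
  intro Aα Aβ sα sβ
  exact lieExp_braid_relations
    (lie_compactGenerator_lie_compactGenerator hθ h𝔞 S hα hβ hαβ hXα hXβ.mem_rootSpace)
    (lie_compactGenerator_lie_compactGenerator hθ h𝔞 S hβ hα
      (by rwa [RootPairing.coxeterWeight_swap]) hXβ hXα.mem_rootSpace) t
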